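/- Let $r\ge 2$ and let $\Gamma_1,\dots,\Gamma_r$ be nontrivial groups, where $\Gamma_i$ is generated by a finite symmetric set $S_i$; exclude the case $r=2=|\Gamma_1|=|\Gamma_2|$. Let $\mathcal X_i$ be the Cayley graph of $\Gamma_i$ with respect to $S_i$, let $\Gamma=\Gamma_1*\dots*\Gamma_r$ be the free product with identity $e$, and let $\mathcal X$ be the Cayley graph of $\Gamma$ with respect to $\bigcup_i S_i$, with graph distance $l(x)$ of $x$ to $e$. A ray is a one-sided infinite path without repeated vertices. Two rays are equivalent if some third ray shares infinitely many vertices with each of them, and an end is an equivalence class of rays. Let $\Omega$ be the set of ends of $\mathcal X$. For $1\le i\le r$ let $\Omega_i\subseteq\Omega$ be the set of all ends $x\omega$, where $x\in\Gamma$, $\omega$ is an end of $\mathcal X_i$, and $x\omega$ is the end represented by $(xy_n)_{n\ge0}$ for any ray $(y_n)_{n\ge0}$ in $\omega$. Let $\Omega_\infty\subseteq\Omega$ be the set of ends described by infinite words $x_1x_2x_3\dots$, where each $x_j$ is a non-identity element of one of the $\Gamma_k$ and consecutive letters lie in different factors; the end described by $x_1x_2x_3\dots$ is the one represented by any ray that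 passes through all the prefixes $x_1\cdots x_n$, $n\ge0$. Fix $\alpha\in(0,1)$. For distinct $\omega_1,\omega_2\in\Omega$ put $d(\omega_1,\omega_2)=\alpha^{c(\omega_1,\omega_2)}$, where $c(\omega_1,\omega_2)$ is the largest $m\ge0$ such that $\omega_1$ and $\omega_2$ lie in the same connected component of $\mathcal X\setminus\{x\in\Gamma: l(x)\le m-1\}$, and put $d(\omega,\omega)=0$. For $A\subseteq\Omega$ and $\delta\ge0$ let $$\mathcal H_\delta(A)=\lim_{\varepsilon\downarrow0}\ \inf\Bigl\{\sum_k\varepsilon_k^{\delta}\Bigr\},$$ where the infimum is over all finite or countable covers of $A$ by balls $\{\omega:d(\omega_k,\omega)\le\varepsilon_k\}$ with $\omega_k\in A$ and $0<\varepsilon_k<\varepsilon$, and let $\mathrm{HD}(A)=\inf\{\delta\ge0:\mathcal H_\delta(A)=0\}$ be the Hausdorff dimension. Then, for every $i\in\{1,\dots,r\}$, $$\mathrm{HD}(\Omega_i)<\mathrm{HD}(\Omega_\infty).$$ -/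

import Mathlib

open scoped ENNReal NNReal

noncomputable section

/-! ### Ends of a graph -/

section GraphEnds

variable {V W : Type*}

/-- A ray: a one-sided infinite path that visits no vertex twice. It may start at any vertex; in a
connected graph every ray is equivalent to one that starts at a prescribed root. -/
structure GraphRay (G : SimpleGraph V) where
  vertex : ℕ → V
  adj : ∀ n, G.Adj (vertex n) (vertex (n + 1))
  injective : Function.Injective vertex

/-- Two rays are equivalent if there is a third ray that shares infinitely many vertices with each
of them. -/
def GraphRay.Equivalent {G : SimpleGraph V} (ρ₁ ρ₂ : GraphRay G) : Prop :=
  ∃ ρ₃ : GraphRay G,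
    (Set.range ρ₃.vertex ∩ Set.range ρ₁.vertex).Infinite ∧
    (Set.range ρ₃.vertex ∩ Set.range ρ₂.vertex).Infinite

/-- The set of ends of a graph: the classes of equivalent rays. -/
def GraphEnd (G : SimpleGraph V) : Type _ :=
  Quot (GraphRay.Equivalent (G := G))

/-- The end represented by a ray. -/
def GraphRay.toEnd {G : SimpleGraph V} (ρ : GraphRay G) : GraphEnd G :=
  Quot.mk _ ρ

/-- The image of a ray under an injective graph homomorphism. -/
def GraphRay.map {G : SimpleGraph V} {H : SimpleGraph W} (f : G →g H)
    (hf : Function.Injective f) (ρ : GraphRay G) : GraphRay H where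
  vertex n := f (ρ.vertex n)
  adj n := f.map_adj (ρ.adj n)
  injective := hf.comp ρ.injective

theorem GraphRay.Equivalent.map {G : SimpleGraph V} {H : SimpleGraph W} (f : G →g H)
    (hf : Function.Injective f) {ρ₁ ρ₂ : GraphRay G} (h : ρ₁.Equivalent ρ₂) :
    (ρ₁.map f hf).Equivalent (ρ₂.map f hf) := by
  have key : ∀ ρ σ : GraphRay G, (Set.range ρ.vertex ∩ Set.range σ.vertex).Infinite →
      (Set.range (ρ.map f hf).vertex ∩ Set.range (σ.map f hf).vertex).Infinite := by
    intro ρ σ hi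
    refine (hi.image hf.injOn).mono ?_
    rintro _ ⟨v, ⟨⟨a, rfl⟩, ⟨b, hb⟩⟩, rfl⟩
    exact ⟨⟨a, rfl⟩, ⟨b, congrArg f hb⟩⟩
  obtain ⟨ρ₃, h₁, h₂⟩ := h
  exact ⟨ρ₃.map f hf, key _ _ h₁, key _ _ h₂⟩

/-- The map on ends induced by an injective graph homomorphism. -/
def GraphEnd.map {G : SimpleGraph V} {H : SimpleGraph W} (f : G →g H)
    (hf : Function.Injective f) : GraphEnd G → GraphEnd H :=
  Quot.map (GraphRay.map f hf) fun _ _ h => h.map f hf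

/-- An end is contained in a set of vertices if each of its representatives has all but finitely
many of its vertices in that set. -/
def GraphEnd.ContainedIn {G : SimpleGraph V} (ω : GraphEnd G) (A : Set V) : Prop :=
  ∀ ρ : GraphRay G, ρ.toEnd = ω → {n | ρ.vertex n ∉ A}.Finite

/-- The two ends lie in the same connected component of the graph that remains when all vertices
at distance less than `m` from the root `o` are removed (nothing is removed if `m = 0`). -/
def GraphEnd.SameComponent {G : SimpleGraph V} (o : V) (m : ℕ) (ω₁ ω₂ : GraphEnd G) : Prop :=
  ∃ C : G.ComponentCompl {v | G.dist o v < m},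
    ω₁.ContainedIn (C : Set V) ∧ ω₂.ContainedIn (C : Set V)

/-- The largest `m` for which the two ends lie in the same component of the complement of the ball
of radius `m - 1` around the root `o`. In a locally finite connected graph distinct ends are
separated by some ball, so that the value is `⊤` exactly when the two ends are equal. -/
def GraphEnd.confluence {G : SimpleGraph V} (o : V) (ω₁ ω₂ : GraphEnd G) : ℕ∞ :=
  ⨆ (m : ℕ) (_ : GraphEnd.SameComponent o m ω₁ ω₂), (m : ℕ∞)

open Classical in
/-- The metric on the space of ends with exponent `α`: the distance of two distinct ends is `α`
to the power of their confluence, and the distance of an end to itself is `0`. -/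
def GraphEnd.endDist {G : SimpleGraph V} (o : V) (α : ℝ) (ω₁ ω₂ : GraphEnd G) : ℝ :=
  if GraphEnd.confluence o ω₁ ω₂ = ⊤ then 0
  else α ^ (GraphEnd.confluence o ω₁ ω₂).toNat

end GraphEnds

/-! ### Hausdorff dimension, through countable covers by closed balls -/

section Hausdorff

variable {X : Type*}

/-- `T` lists the centres and radii of a finite or countable family of closed balls that covers
`A`, with centres in `A` and positive radii smaller than `ε`. -/
def IsBallCover (d : X → X → ℝ) (A : Set X) (ε : ℝ) (T : Set (X × ℝ)) : Prop :=
  T.Countable ∧ (∀ p ∈ T, p.1 ∈ A ∧ 0 < p.2 ∧ p.2 < ε) ∧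
    A ⊆ ⋃ p ∈ T, {x | d p.1 x ≤ p.2}

/-- The `δ`-dimensional Hausdorff measure of `A`. The infimum over covers increases as `ε`
decreases, so the supremum over `ε > 0` is the limit for `ε → 0`. -/
def ballHausdorffMeasure (d : X → X → ℝ) (δ : ℝ≥0) (A : Set X) : ℝ≥0∞ :=
  ⨆ (ε : ℝ) (_ : 0 < ε), ⨅ (T : Set (X × ℝ)) (_ : IsBallCover d A ε T),
    ∑' p : T, ENNReal.ofReal p.1.2 ^ (δ : ℝ)

/-- The Hausdorff dimension of `A`: the infimum of all `δ ≥ 0` for which the `δ`-dimensional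
Hausdorff measure of `A` is zero. -/
def ballHausdorffDim (d : X → X → ℝ) (A : Set X) : ℝ≥0∞ :=
  ⨅ (δ : ℝ≥0) (_ : ballHausdorffMeasure d δ A = 0), (δ : ℝ≥0∞)

end Hausdorff

/-! ### Free products and their ends -/

section FreeProduct

open Monoid

variable {ι : Type*} {Γ : ι → Type*} [∀ i, Group (Γ i)]

/-- The Cayley graph of the free product of the groups `Γ i` with respect to the union of the
generating sets `S i` of the factors. -/
def freeProductGraph (S : ∀ i, Set (Γ i)) : SimpleGraph (CoprodI Γ) :=
  SimpleGraph.mulCayley (⋃ i, (CoprodI.of : Γ i →* CoprodI Γ) '' S i)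

/-- The embedding of the Cayley graph of the factor `Γ i` onto the copy of it that is attached at
the vertex `x` of the free product. -/
def factorCopy (S : ∀ i, Set (Γ i)) (i : ι) (x : CoprodI Γ) :
    SimpleGraph.mulCayley (S i) →g freeProductGraph S where
  toFun y := x * CoprodI.of y
  map_rel' {a b} h := by
    rw [SimpleGraph.mulCayley_adj'] at h
    rw [freeProductGraph, SimpleGraph.mulCayley_adj']
    obtain ⟨hne, g, hg, h⟩ := h
    refine ⟨fun e => hne (CoprodI.of_injective i (mul_left_cancel e)), CoprodI.of g,
      Set.mem_iUnion.2 ⟨i, g, hg, rfl⟩, ?_⟩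
    rcases h with h | h
    · exact Or.inl (by rw [mul_assoc, ← map_mul, h])
    · exact Or.inr (by rw [mul_assoc, ← map_mul, h])

theorem factorCopy_injective (S : ∀ i, Set (Γ i)) (i : ι) (x : CoprodI Γ) :
    Function.Injective (factorCopy S i x) :=
  fun _ _ h => CoprodI.of_injective i (mul_left_cancel h)

/-- The ends `x ω` of the free product, where `x` is an element of the free product and `ω` is an
end of the Cayley graph of the factor `Γ i`. -/
def factorEnds (S : ∀ i, Set (Γ i)) (i : ι) : Set (GraphEnd (freeProductGraph S)) :=
  {ω | ∃ (x : CoprodI Γ) (ξ : GraphEnd (SimpleGraph.mulCayley (S i))),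
    ω = ξ.map (factorCopy S i x) (factorCopy_injective S i x)}

/-- An infinite word: a sequence of nontrivial elements of the factors, no two consecutive ones of
which come from the same factor. -/
def IsInfiniteWord (w : ℕ → Σ i, Γ i) : Prop :=
  ∀ n, (w n).2 ≠ 1 ∧ (w n).1 ≠ (w (n + 1)).1

/-- The product of the first `n` letters of an infinite word. -/
def wordPrefix (w : ℕ → Σ i, Γ i) (n : ℕ) : CoprodI Γ :=
  ((List.range n).map fun k => CoprodI.of (w k).2).prod

/-- The ends that are described by infinite words: those represented by a ray that passes through
all finite prefixes of an infinite word. (Two rays through all prefixes of the same word share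
infinitely many vertices, so they represent the same end.) -/
def infiniteWordEnds (S : ∀ i, Set (Γ i)) : Set (GraphEnd (freeProductGraph S)) :=
  {ω | ∃ w : ℕ → Σ i, Γ i, IsInfiniteWord w ∧
    ∃ ρ : GraphRay (freeProductGraph S), ρ.toEnd = ω ∧ ∀ n, wordPrefix w n ∈ Set.range ρ.vertex}

/-- The Hausdorff dimension of a set of ends of the free product, with respect to the metric on
ends with exponent `α` and root the identity. -/
def endHausdorffDim (S : ∀ i, Set (Γ i)) (α : ℝ) (A : Set (GraphEnd (freeProductGraph S))) :
    ℝ≥0∞ :=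
  ballHausdorffDim (GraphEnd.endDist 1 α) A

end FreeProduct

end

/-!
An end of a copy of the Cayley graph of `Γ i` is determined up to distance `α ^ k` by the component
outside a ball that contains it, and each such component meets the sphere around the ball. So the
number of elements of `Γ i` of a given word length controls the covers of each of the countably many
copies, and `Ω_i` has dimension at most the critical exponent `c` of the growth series
`∑ (α ^ δ) ^ l(x)` of `Γ i`.

For the lower bound, let `T` be a finite set of letters from `Γ i` and `Y` one of letters from the
other factors, and consider the infinite words that take their letters alternately from `T` and `Y`.
In a free product the path to an end has to pass through every prefix of its word, so two such ends
are close only if the words have a long common prefix. The Bernoulli measure that gives a pair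
`(x, y)` a weight proportional to `(α ^ δ) ^ (l(x) + l(y))` is then a mass distribution which shows
that the `δ`-dimensional measure of `Ω_∞` is nonzero whenever
`∑_T (α ^ δ) ^ l(x) * ∑_Y (α ^ δ) ^ l(y) ≥ 1`.

At `δ = c` this product can be made larger than `1`: if `Γ i` is infinite, subadditivity makes its
growth series diverge at the critical exponent; if it is finite, then `c = 0` and two letters on one
of the two sides suffice, which exist outside the excluded case. As the product is continuous in
`δ`, it still exceeds `1` at some `δ > c`.
-/

section GraphDist

open SimpleGraph

variable {V W : Type*} {G : SimpleGraph V} {H : SimpleGraph W}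

theorem graphDist_map_le (hG : G.Connected) (f : G →g H) (u v : V) :
    H.dist (f u) (f v) ≤ G.dist u v := by
  obtain ⟨p, hp⟩ := hG.exists_walk_length_eq_dist u v
  rw [← hp, ← Walk.length_map f p]
  exact dist_le _

theorem le_add_graphDist_of_forall_adj (hG : G.Connected) {f : V → ℕ}
    (hf : ∀ u v, G.Adj u v → f v ≤ f u + 1) (u v : V) : f v ≤ f u + G.dist u v := by
  have key : ∀ (u v : V) (p : G.Walk u v), f v ≤ f u + p.length := by
    intro u v p
    induction p with
    | nil => simp
    | cons h p ih =>
      have := hf _ _ h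
      rw [Walk.length_cons]
      lia
  obtain ⟨p, hp⟩ := hG.exists_walk_length_eq_dist u v
  exact hp ▸ key u v p

theorem exists_graphDist_eq_graphDist_eq (hG : G.Connected) {o v : V} {m n : ℕ}
    (h : G.dist o v = m + n) : ∃ u, G.dist o u = m ∧ G.dist u v = n := by
  obtain ⟨p, hp⟩ := hG.exists_walk_length_eq_dist o v
  have h₁ : G.dist o (p.getVert m) ≤ m :=
    (dist_le (p.take m)).trans (by rw [Walk.take_length]; exact min_le_left _ _)
  have h₂ : G.dist (p.getVert m) v ≤ n :=
    (dist_le (p.drop m)).trans (by rw [Walk.drop_length]; lia)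
  have h₃ := hG.dist_triangle (u := o) (v := p.getVert m) (w := v)
  exact ⟨p.getVert m, by lia, by lia⟩

theorem exists_mem_componentCompl_graphDist_eq (hG : G.Connected) {o : V} {m : ℕ}
    (C : G.ComponentCompl {v | G.dist o v < m}) : ∃ z ∈ C, G.dist o z = m := by
  have key : ∀ k, ∀ v ∈ C, G.dist o v = m + k → ∃ z ∈ C, G.dist o z = m := by
    intro k
    induction k with
    | zero => exact fun v hv hk => ⟨v, hv, hk⟩
    | succ k ih =>
      intro v hv hk
      obtain ⟨u, hu, huv⟩ := exists_graphDist_eq_graphDist_eq hG (m := m + k) (n := 1) hk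
      have hK : u ∉ {v | G.dist o v < m} := by simp [hu]
      exact ih u (ComponentCompl.mem_of_adj v u hv hK (dist_eq_one_iff_adj.1 huv).symm) hu
  obtain ⟨v, hv⟩ := C.nonempty
  have hm : m ≤ G.dist o v := not_lt.1 fun h => ComponentCompl.notMem_of_mem hv h
  obtain ⟨k, hk⟩ := Nat.exists_eq_add_of_le hm
  exact key k v hv hk

theorem finite_setOf_graphDist_lt (hG : G.Connected) (hfin : ∀ v, (G.neighborSet v).Finite) (o : V)
    (m : ℕ) : {v | G.dist o v < m}.Finite := by
  induction m with
  | zero => simp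
  | succ m ih =>
    refine ((Set.finite_singleton o).union (ih.biUnion fun u _ => hfin u)).subset fun v hv => ?_
    replace hv : G.dist o v < m + 1 := hv
    obtain h | hn := Nat.eq_zero_or_eq_succ_pred (G.dist o v)
    · exact Or.inl (hG.dist_eq_zero_iff.1 h).symm
    · obtain ⟨u, hu, huv⟩ := exists_graphDist_eq_graphDist_eq hG (n := 1) hn
      have hum : G.dist o u < m := by lia
      exact Or.inr (Set.mem_biUnion (x := u) hum (dist_eq_one_iff_adj.1 huv))

end GraphDist

section ConcatWalk

open SimpleGraph

variable {V : Type*} {G : SimpleGraph V} {p : ℕ → V}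

/-- The concatenation of the first `n` walks of an infinite sequence of walks, each of which starts
where the preceding one stops. -/
def concatWalk (q : ∀ n, G.Walk (p n) (p (n + 1))) : ∀ n, G.Walk (p 0) (p n)
  | 0 => Walk.nil
  | n + 1 => (concatWalk q n).append (q n)

variable {q : ∀ n, G.Walk (p n) (p (n + 1))}

theorem le_length_concatWalk (hne : ∀ n, p n ≠ p (n + 1)) (n : ℕ) :
    n ≤ (concatWalk q n).length := by
  induction n with
  | zero => exact Nat.zero_le _
  | succ n ih =>
    have hq : (q n).length ≠ 0 := fun h => hne n (Walk.eq_of_length_eq_zero h)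
    rw [concatWalk, Walk.length_append]
    lia

theorem getVert_concatWalk_of_le {m n k : ℕ} (hmn : m ≤ n) (hk : k ≤ (concatWalk q m).length) :
    (concatWalk q n).getVert k = (concatWalk q m).getVert k := by
  have key : k ≤ (concatWalk q n).length ∧
      (concatWalk q n).getVert k = (concatWalk q m).getVert k := by
    induction n, hmn using Nat.le_induction with
    | base => exact ⟨hk, rfl⟩
    | succ n _ ih =>
      rw [concatWalk, Walk.length_append, Walk.getVert_append, ← ih.2]
      refine ⟨by lia, ?_⟩
      obtain h | h := ih.1.lt_or_eq
      · rw [if_pos h]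
      · simp [h]
  exact key.2

theorem exists_graphRay_of_isPath_concatWalk (hne : ∀ n, p n ≠ p (n + 1))
    (hq : ∀ n, (concatWalk q n).IsPath) :
    ∃ ρ : GraphRay G, ∀ n, p n ∈ Set.range ρ.vertex := by
  have hle := le_length_concatWalk (q := q) hne
  have hvert : ∀ {k n}, k ≤ n → (concatWalk q k).getVert k = (concatWalk q n).getVert k :=
    fun hk => (getVert_concatWalk_of_le hk (hle _)).symm
  refine ⟨⟨fun k => (concatWalk q k).getVert k, fun k => ?_, fun a b hab => ?_⟩, fun n => ?_⟩
  · rw [hvert k.le_succ]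
    exact (concatWalk q (k + 1)).adj_getVert_succ (hle (k + 1))
  · replace hab : (concatWalk q a).getVert a = (concatWalk q b).getVert b := hab
    rw [hvert (le_max_left a b), hvert (le_max_right a b)] at hab
    exact (hq (max a b)).getVert_injOn ((le_max_left a b).trans (hle _))
      ((le_max_right a b).trans (hle _)) hab
  · refine ⟨(concatWalk q n).length, ?_⟩
    change (concatWalk q (concatWalk q n).length).getVert (concatWalk q n).length = p n
    rw [getVert_concatWalk_of_le (hle n) le_rfl, Walk.getVert_length]

theorem exists_graphRay_of_graphDist_eq_add (hG : G.Connected) (hne : ∀ n, p n ≠ p (n + 1))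
    (hp : ∀ n, G.dist (p 0) (p (n + 1)) = G.dist (p 0) (p n) + G.dist (p n) (p (n + 1))) :
    ∃ ρ : GraphRay G, ∀ n, p n ∈ Set.range ρ.vertex := by
  choose q hq using fun n => hG.exists_walk_length_eq_dist (p n) (p (n + 1))
  have hlen : ∀ n, (concatWalk q n).length = G.dist (p 0) (p n) := by
    intro n
    induction n with
    | zero => simp [concatWalk]
    | succ n ih => rw [concatWalk, Walk.length_append, ih, hq, hp]
  exact exists_graphRay_of_isPath_concatWalk hne fun n => Walk.isPath_of_length_eq_dist _ (hlen n)

end ConcatWalk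

section EndComponents

open Filter SimpleGraph

variable {V W : Type*} {G : SimpleGraph V} {H : SimpleGraph W}

theorem componentCompl_eq_of_mem {K : Set V} {C D : G.ComponentCompl K} {v : V} (hC : v ∈ C)
    (hD : v ∈ D) : C = D :=
  ComponentCompl.pairwise_disjoint.eq (Set.not_disjoint_iff.2 ⟨v, hC, hD⟩)

theorem GraphRay.exists_eventually_mem_componentCompl (ρ : GraphRay G) {K : Set V}
    (hK : K.Finite) : ∃ C : G.ComponentCompl K, ∀ᶠ n in atTop, ρ.vertex n ∈ C := by
  have h : ∀ᶠ n in atTop, ρ.vertex n ∉ K := by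
    rw [← Nat.cofinite_eq_atTop]
    exact (hK.preimage ρ.injective.injOn).eventually_cofinite_notMem
  obtain ⟨N, hN⟩ := eventually_atTop.1 h
  refine ⟨G.componentComplMk (hN N le_rfl), eventually_atTop.2 ⟨N, fun n hn => ?_⟩⟩
  induction n, hn using Nat.le_induction with
  | base => exact componentComplMk_mem G _
  | succ n hn ih => exact ComponentCompl.mem_of_adj _ _ ih (hN _ (by lia)) (ρ.adj n)

theorem GraphRay.componentCompl_eq_of_infinite_inter {ρ σ : GraphRay G} {K : Set V}
    (h : (Set.range ρ.vertex ∩ Set.range σ.vertex).Infinite) {C D : G.ComponentCompl K}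
    (hC : ∀ᶠ n in atTop, ρ.vertex n ∈ C) (hD : ∀ᶠ n in atTop, σ.vertex n ∈ D) : C = D := by
  rw [← Nat.cofinite_eq_atTop, eventually_cofinite] at hC hD
  obtain ⟨v, ⟨⟨a, rfl⟩, ⟨b, hb⟩⟩, hv⟩ :=
    (h.sdiff ((hC.image ρ.vertex).union (hD.image σ.vertex))).nonempty
  exact componentCompl_eq_of_mem (not_not.1 fun hc => hv (Or.inl ⟨a, hc, rfl⟩))
    (not_not.1 fun hc => hv (Or.inr ⟨b, fun h => hc (hb ▸ h), hb⟩))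

theorem GraphRay.Equivalent.eventually_mem {ρ σ : GraphRay G} (h : ρ.Equivalent σ) {K : Set V}
    (hK : K.Finite) {C : G.ComponentCompl K} (hC : ∀ᶠ n in atTop, ρ.vertex n ∈ C) :
    ∀ᶠ n in atTop, σ.vertex n ∈ C := by
  obtain ⟨τ, h₁, h₂⟩ := h
  obtain ⟨D, hD⟩ := τ.exists_eventually_mem_componentCompl hK
  obtain ⟨E, hE⟩ := σ.exists_eventually_mem_componentCompl hK
  rwa [← componentCompl_eq_of_infinite_inter h₁ hD hC, componentCompl_eq_of_infinite_inter h₂ hD hE]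

theorem GraphRay.Equivalent.symm {ρ σ : GraphRay G} (h : ρ.Equivalent σ) : σ.Equivalent ρ := by
  obtain ⟨τ, h₁, h₂⟩ := h
  exact ⟨τ, h₂, h₁⟩

theorem GraphEnd.ContainedIn.eventually_mem {ρ : GraphRay G} {A : Set V}
    (h : ρ.toEnd.ContainedIn A) : ∀ᶠ n in atTop, ρ.vertex n ∈ A := by
  rw [← Nat.cofinite_eq_atTop, eventually_cofinite]
  exact h ρ rfl

theorem GraphRay.toEnd_containedIn {ρ : GraphRay G} {K : Set V} (hK : K.Finite)
    {C : G.ComponentCompl K} (hC : ∀ᶠ n in atTop, ρ.vertex n ∈ C) :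
    ρ.toEnd.ContainedIn (C : Set V) := by
  intro σ hσ
  let P : GraphEnd G → Prop := Quot.lift (fun τ => ∀ᶠ n in atTop, τ.vertex n ∈ C)
    fun τ τ' h => propext ⟨h.eventually_mem hK, h.symm.eventually_mem hK⟩
  have hP : P σ.toEnd = P ρ.toEnd := congrArg P hσ
  have h : ∀ᶠ n in atTop, σ.vertex n ∈ C := hP.mpr hC
  rwa [← Nat.cofinite_eq_atTop, eventually_cofinite] at h

theorem GraphEnd.exists_toEnd_eq (ω : GraphEnd G) : ∃ ρ : GraphRay G, ρ.toEnd = ω :=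
  Quot.exists_rep ω

theorem GraphEnd.exists_containedIn_componentCompl (ω : GraphEnd G) {K : Set V}
    (hK : K.Finite) : ∃ C : G.ComponentCompl K, ω.ContainedIn (C : Set V) := by
  obtain ⟨ρ, rfl⟩ := ω.exists_toEnd_eq
  obtain ⟨C, hC⟩ := ρ.exists_eventually_mem_componentCompl hK
  exact ⟨C, ρ.toEnd_containedIn hK hC⟩

theorem GraphEnd.ContainedIn.componentCompl_eq {ω : GraphEnd G} {K : Set V}
    {C D : G.ComponentCompl K} (hC : ω.ContainedIn (C : Set V)) (hD : ω.ContainedIn (D : Set V)) :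
    C = D := by
  obtain ⟨ρ, rfl⟩ := ω.exists_toEnd_eq
  obtain ⟨n, hnC, hnD⟩ := (hC.eventually_mem.and hD.eventually_mem).exists
  exact componentCompl_eq_of_mem hnC hnD

theorem GraphEnd.ContainedIn.mono {ω : GraphEnd G} {A B : Set V} (h : ω.ContainedIn A)
    (hAB : A ⊆ B) : ω.ContainedIn B :=
  fun ρ hρ => (h ρ hρ).subset fun _ hn hA => hn (hAB hA)

theorem GraphEnd.ContainedIn.map {ω : GraphEnd G} {K : Set V} {L : Set W} (hL : L.Finite)
    {C : G.ComponentCompl K} (h : ω.ContainedIn (C : Set V)) {f : G →g H}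
    (hf : Function.Injective f) (hKL : Set.MapsTo f Kᶜ Lᶜ) :
    (ω.map f hf).ContainedIn
      (ConnectedComponent.map (induceHom f hKL) C : H.ComponentCompl L) := by
  obtain ⟨ρ, rfl⟩ := ω.exists_toEnd_eq
  refine GraphRay.toEnd_containedIn hL (h.eventually_mem.mono fun n hn => ?_)
  obtain ⟨hv, rfl⟩ := hn
  exact ⟨hKL hv, rfl⟩

theorem GraphEnd.SameComponent.symm {o : V} {m : ℕ} {ω₁ ω₂ : GraphEnd G}
    (h : SameComponent o m ω₁ ω₂) : SameComponent o m ω₂ ω₁ := by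
  obtain ⟨C, h₁, h₂⟩ := h
  exact ⟨C, h₂, h₁⟩

theorem GraphEnd.SameComponent.trans {o : V} {m : ℕ} {ω₁ ω₂ ω₃ : GraphEnd G}
    (h : SameComponent o m ω₁ ω₂) (h' : SameComponent o m ω₂ ω₃) : SameComponent o m ω₁ ω₃ := by
  obtain ⟨C, hC₁, hC₂⟩ := h
  obtain ⟨D, hD₂, hD₃⟩ := h'
  obtain rfl := hC₂.componentCompl_eq hD₂
  exact ⟨C, hC₁, hD₃⟩

theorem GraphEnd.SameComponent.anti {o : V} {m n : ℕ} (hmn : m ≤ n) {ω₁ ω₂ : GraphEnd G}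
    (h : SameComponent o n ω₁ ω₂) : SameComponent o m ω₁ ω₂ := by
  obtain ⟨C, h₁, h₂⟩ := h
  have hK : {v | G.dist o v < m} ⊆ {v | G.dist o v < n} := fun v hv => lt_of_lt_of_le hv hmn
  exact ⟨C.hom hK, h₁.mono (C.subset_hom hK), h₂.mono (C.subset_hom hK)⟩

theorem GraphEnd.SameComponent.map {o : V} {o' : W} {m n : ℕ} {ω₁ ω₂ : GraphEnd G}
    (h : SameComponent o m ω₁ ω₂) {f : G →g H} (hf : Function.Injective f)
    (hfin : {w | H.dist o' w < n}.Finite) (hfn : ∀ v, H.dist o' (f v) < n → G.dist o v < m) :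
    SameComponent o' n (ω₁.map f hf) (ω₂.map f hf) := by
  obtain ⟨C, h₁, h₂⟩ := h
  have hK : Set.MapsTo f {v | G.dist o v < m}ᶜ {w | H.dist o' w < n}ᶜ :=
    fun v hv hfv => hv (hfn v hfv)
  exact ⟨_, h₁.map hfin hf hK, h₂.map hfin hf hK⟩

theorem GraphEnd.exists_encard_le_forall_sameComponent (hG : G.Connected) {o : V} {m : ℕ}
    (hfin : {v | G.dist o v < m}.Finite) :
    ∃ F : Set (GraphEnd G), F.encard ≤ {v | G.dist o v = m}.encard ∧
      ∀ ω, ∃ c ∈ F, SameComponent o m c ω := by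
  choose C hC using fun ω : GraphEnd G => ω.exists_containedIn_componentCompl hfin
  choose z hzC hz using fun ω => exists_mem_componentCompl_graphDist_eq hG (C ω)
  obtain ⟨F, hFz, hF⟩ := Set.exists_image_eq_and_injOn Set.univ z
  refine ⟨F, ?_, fun ω => ?_⟩
  · rw [← hF.encard_image]
    exact Set.encard_le_encard (Set.image_subset_iff.2 fun ω _ => hz ω)
  · obtain ⟨c, hcF, hc⟩ : z ω ∈ z '' F := hFz ▸ Set.mem_image_of_mem z (Set.mem_univ ω)
    have hcω : C c = C ω := componentCompl_eq_of_mem (hc ▸ hzC c) (hzC ω)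
    exact ⟨c, hcF, C ω, hcω ▸ hC c, hC ω⟩

variable {o : V} {α : ℝ} {m : ℕ} {ω₁ ω₂ : GraphEnd G}

theorem GraphEnd.endDist_le_pow (hα0 : 0 < α) (hα1 : α < 1) (h : SameComponent o m ω₁ ω₂) :
    endDist o α ω₁ ω₂ ≤ α ^ m := by
  unfold endDist
  split_ifs with ht
  · positivity
  · have hm : (m : ℕ∞) ≤ confluence o ω₁ ω₂ :=
      le_iSup₂ (f := fun (m : ℕ) (_ : SameComponent o m ω₁ ω₂) => (m : ℕ∞)) m h
    obtain ⟨c, hc⟩ := ENat.ne_top_iff_exists.1 ht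
    rw [← hc] at hm ⊢
    exact pow_le_pow_of_le_one hα0.le hα1.le (by simpa using hm)

theorem GraphEnd.sameComponent_of_endDist_lt (hα0 : 0 < α) (hα1 : α < 1)
    (h : endDist o α ω₁ ω₂ < α ^ m) : SameComponent o (m + 1) ω₁ ω₂ := by
  have hm : (m : ℕ∞) < confluence o ω₁ ω₂ := by
    unfold endDist at h
    split_ifs at h with ht
    · exact ht ▸ ENat.natCast_lt_top m
    · obtain ⟨c, hc⟩ := ENat.ne_top_iff_exists.1 ht
      rw [← hc] at h ⊢
      rw [pow_lt_pow_iff_right_of_lt_one₀ hα0 hα1] at h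
      simpa using h
  obtain ⟨n, hn⟩ := lt_iSup_iff.1 hm
  obtain ⟨hn, hmn⟩ := lt_iSup_iff.1 hn
  exact hn.anti (by exact_mod_cast hmn)

end EndComponents

section CayleyGraph

open SimpleGraph

variable {G : Type*} [Group G] {S : Set G}

/-- The word length of `g` with respect to `S`, as the distance from the identity in the Cayley
graph. It has the junk value `0` at elements outside the subgroup generated by `S`. -/
noncomputable def cayleyLength (S : Set G) (g : G) : ℕ :=
  (mulCayley S).dist 1 g

/-- Left multiplication as an endomorphism of the Cayley graph. -/
def mulCayleyLeftMul (S : Set G) (g : G) : mulCayley S →g mulCayley S where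
  toFun x := g * x
  map_rel' h := mulCayley_adj_mul_iff_right.2 h

theorem mulCayley_connected (h : Subgroup.closure S = ⊤) : (mulCayley S).Connected := by
  have hmul : ∀ {a b : G} (g : G), (mulCayley S).Reachable a b →
      (mulCayley S).Reachable (g * a) (g * b) := fun g h => h.map (mulCayleyLeftMul S g)
  have hone : ∀ g : G, (mulCayley S).Reachable 1 g := by
    intro g
    have hg : g ∈ Subgroup.closure S := h ▸ Subgroup.mem_top g
    induction hg using Subgroup.closure_induction with
    | mem x hx =>
      by_cases hx1 : x = 1
      · rw [hx1]
      · exact Adj.reachable ((mulCayley_adj' S 1 x).2 ⟨Ne.symm hx1, x, hx, by simp⟩)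
    | one => rfl
    | mul a b _ _ ha hb => exact ha.trans (by simpa using hmul a hb)
    | inv a _ ha => exact (by simpa using hmul a⁻¹ ha : (mulCayley S).Reachable a⁻¹ 1).symm
  exact ⟨fun a b => (hone a).symm.trans (hone b)⟩

@[simp]
theorem cayleyLength_one : cayleyLength S 1 = 0 :=
  dist_self

theorem cayleyLength_le_one {s : G} (hs : s ∈ S) : cayleyLength S s ≤ 1 := by
  by_cases h : s = 1
  · simp [h]
  · exact (dist_eq_one_iff_adj.2 ((mulCayley_adj' S 1 s).2 ⟨Ne.symm h, s, hs, by simp⟩)).le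

variable (hS : Subgroup.closure S = ⊤)
include hS

theorem cayleyLength_inv_mul (a b : G) :
    cayleyLength S (a⁻¹ * b) = (mulCayley S).dist a b := by
  have hle : ∀ g u v : G, (mulCayley S).dist (g * u) (g * v) ≤ (mulCayley S).dist u v :=
    fun g => graphDist_map_le (mulCayley_connected hS) (mulCayleyLeftMul S g)
  refine le_antisymm ?_ ?_
  · simpa [cayleyLength] using hle a⁻¹ a b
  · simpa [cayleyLength] using hle a 1 (a⁻¹ * b)

theorem cayleyLength_inv (g : G) : cayleyLength S g⁻¹ = cayleyLength S g := by
  simpa [dist_comm, cayleyLength] using cayleyLength_inv_mul hS g 1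

theorem cayleyLength_mul_le (a b : G) :
    cayleyLength S (a * b) ≤ cayleyLength S a + cayleyLength S b := by
  have h := (mulCayley_connected hS).dist_triangle (u := 1) (v := a) (w := a * b)
  rwa [← cayleyLength_inv_mul hS a, inv_mul_cancel_left] at h

theorem cayleyLength_pos {g : G} (hg : g ≠ 1) : 0 < cayleyLength S g :=
  (mulCayley_connected hS).pos_dist_of_ne hg.symm

theorem le_cayleyLength {f : G → ℕ} (h1 : f 1 = 0) (hf : ∀ s ∈ S, ∀ g, f (s * g) ≤ f g + 1)
    (hf' : ∀ s ∈ S, ∀ g, f (s⁻¹ * g) ≤ f g + 1) (g : G) : f g ≤ cayleyLength S g := by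
  have hadj : ∀ u v, (mulCayley S).Adj u v → f v⁻¹ ≤ f u⁻¹ + 1 := by
    intro u v huv
    obtain ⟨-, s, hs, rfl | rfl⟩ := (mulCayley_adj' S u v).1 huv
    · simpa using hf' s hs u⁻¹
    · simpa using hf s hs (v * s)⁻¹
  have := le_add_graphDist_of_forall_adj (mulCayley_connected hS) hadj 1 g⁻¹
  rwa [inv_inv, inv_one, h1, zero_add, ← cayleyLength_inv_mul hS, inv_one, one_mul,
    cayleyLength_inv hS] at this

theorem exists_mul_eq_cayleyLength_eq {g : G} {m n : ℕ} (hg : cayleyLength S g = m + n) :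
    ∃ a b, a * b = g ∧ cayleyLength S a = m ∧ cayleyLength S b = n := by
  obtain ⟨u, hu, hug⟩ := exists_graphDist_eq_graphDist_eq (mulCayley_connected hS) hg
  exact ⟨u, u⁻¹ * g, mul_inv_cancel_left u g, hu, (cayleyLength_inv_mul hS u g).trans hug⟩

variable (hfin : S.Finite)
include hfin

theorem finite_setOf_cayleyLength_lt (m : ℕ) : {g | cayleyLength S g < m}.Finite := by
  refine finite_setOf_graphDist_lt (mulCayley_connected hS) (fun v => ?_) 1 m
  refine ((hfin.image (v * ·)).union (hfin.image (v * ·⁻¹))).subset fun u hu => ?_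
  obtain ⟨-, s, hs, rfl | rfl⟩ := (mulCayley_adj' S v u).1 hu
  · exact Or.inl ⟨s, hs, rfl⟩
  · exact Or.inr ⟨s, hs, by simp⟩

theorem finite_setOf_cayleyLength_eq (m : ℕ) : {g | cayleyLength S g = m}.Finite :=
  (finite_setOf_cayleyLength_lt hS hfin (m + 1)).subset fun _ hg => Nat.lt_succ_of_le hg.le

theorem countable_of_closure_eq_top : Countable G := by
  rw [← Set.countable_univ_iff]
  refine (Set.countable_iUnion fun m =>
    (finite_setOf_cayleyLength_lt hS hfin m).countable).mono fun g _ => ?_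
  exact Set.mem_iUnion.2 ⟨cayleyLength S g + 1, Nat.lt_succ_self _⟩

end CayleyGraph

section Growth

open Filter Topology

variable {G : Type*} [Group G] {S : Set G}

/-- The number of elements of word length `n`: the spherical growth function of the group with
respect to `S`. -/
noncomputable def sphereCard (S : Set G) (n : ℕ) : ℕ :=
  {g | cayleyLength S g = n}.ncard

/-- The exponential growth rate `inf (log (sphereCard S n) / n)` of the group with respect to `S`.
The empty spheres of a finite group contribute `log 0 / n = 0`, so that a finite group has growth
rate zero. -/
noncomputable def growthRate (S : Set G) : ℝ :=
  sInf ((fun n : ℕ => Real.log (sphereCard S n) / n) '' Set.Ici 1)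

theorem log_sphereCard_div_nonneg (S : Set G) (n : ℕ) : 0 ≤ Real.log (sphereCard S n) / n :=
  div_nonneg (Real.log_natCast_nonneg _) n.cast_nonneg

theorem bddBelow_range_log_sphereCard_div (S : Set G) :
    BddBelow (Set.range fun n : ℕ => Real.log (sphereCard S n) / n) :=
  ⟨0, by rintro _ ⟨n, rfl⟩; exact log_sphereCard_div_nonneg S n⟩

theorem growthRate_nonneg (S : Set G) : 0 ≤ growthRate S :=
  Real.sInf_nonneg (by rintro _ ⟨n, -, rfl⟩; exact log_sphereCard_div_nonneg S n)

theorem growthRate_le_log_sphereCard_div (S : Set G) {n : ℕ} (hn : n ≠ 0) :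
    growthRate S ≤ Real.log (sphereCard S n) / n :=
  csInf_le ((bddBelow_range_log_sphereCard_div S).mono (Set.image_subset_range _ _))
    ⟨n, Nat.one_le_iff_ne_zero.2 hn, rfl⟩

theorem sphereCard_add_le (hS : Subgroup.closure S = ⊤) (hfin : S.Finite) (m n : ℕ) :
    sphereCard S (m + n) ≤ sphereCard S m * sphereCard S n := by
  have hprod := (finite_setOf_cayleyLength_eq hS hfin m).prod
    (finite_setOf_cayleyLength_eq hS hfin n)
  rw [sphereCard, sphereCard, sphereCard, ← Set.ncard_prod]
  refine (Set.ncard_le_ncard (fun g hg => ?_) (hprod.image fun p => p.1 * p.2)).trans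
    (Set.ncard_image_le hprod)
  obtain ⟨a, b, rfl, ha, hb⟩ := exists_mul_eq_cayleyLength_eq hS hg
  exact ⟨(a, b), ⟨ha, hb⟩, rfl⟩

theorem one_le_sphereCard [Infinite G] (hS : Subgroup.closure S = ⊤) (hfin : S.Finite) (n : ℕ) :
    1 ≤ sphereCard S n := by
  obtain ⟨g, hg⟩ := (finite_setOf_cayleyLength_lt hS hfin n).exists_notMem
  obtain ⟨k, hk⟩ := Nat.exists_eq_add_of_le (not_lt.1 hg)
  obtain ⟨a, -, -, ha, -⟩ := exists_mul_eq_cayleyLength_eq hS hk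
  exact (Set.ncard_pos (finite_setOf_cayleyLength_eq hS hfin n)).2 ⟨a, ha⟩

theorem growthRate_eq_zero_of_finite [Finite G] (S : Set G) : growthRate S = 0 := by
  obtain ⟨N, hN⟩ := (Set.finite_range (cayleyLength S)).bddAbove
  have hempty : sphereCard S (N + 1) = 0 := by
    have : {g | cayleyLength S g = N + 1} = ∅ := Set.eq_empty_of_forall_notMem fun g hg =>
      absurd (hN ⟨g, rfl⟩) (by simp [Set.mem_ofPred_eq.mp hg])
    rw [sphereCard, this, Set.ncard_empty]
  exact le_antisymm (by simpa [hempty] using growthRate_le_log_sphereCard_div S N.succ_ne_zero)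
    (growthRate_nonneg S)

theorem subadditive_log_sphereCard (hS : Subgroup.closure S = ⊤) (hfin : S.Finite) :
    Subadditive fun n => Real.log (sphereCard S n) := by
  intro m n
  obtain h0 | hpos := (sphereCard S (m + n)).eq_zero_or_pos
  · simpa [h0] using add_nonneg (Real.log_natCast_nonneg (sphereCard S m))
      (Real.log_natCast_nonneg (sphereCard S n))
  · have hmul := sphereCard_add_le hS hfin m n
    obtain ⟨hm, hn⟩ := mul_ne_zero_iff.1 (hpos.trans_le hmul).ne'
    rw [← Real.log_mul (by exact_mod_cast hm) (by exact_mod_cast hn)]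
    exact Real.log_le_log (by exact_mod_cast hpos) (by exact_mod_cast hmul)

theorem tendsto_log_sphereCard_div (hS : Subgroup.closure S = ⊤) (hfin : S.Finite) :
    Tendsto (fun n : ℕ => Real.log (sphereCard S n) / n) atTop (𝓝 (growthRate S)) := by
  have h := subadditive_log_sphereCard hS hfin
  have hlim : h.lim = growthRate S := by rw [Subadditive.lim, growthRate]
  exact hlim ▸ h.tendsto_lim (bddBelow_range_log_sphereCard_div S)

theorem one_le_sphereCard_mul_exp_pow [Infinite G] (hS : Subgroup.closure S = ⊤)
    (hfin : S.Finite) (n : ℕ) : 1 ≤ sphereCard S n * Real.exp (-growthRate S) ^ n := by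
  have hpos : (0 : ℝ) < sphereCard S n := by exact_mod_cast one_le_sphereCard hS hfin n
  have hle : n * growthRate S ≤ Real.log (sphereCard S n) := by
    obtain rfl | hn := eq_or_ne n 0
    · simpa using Real.log_natCast_nonneg _
    · rw [mul_comm, ← le_div_iff₀ (by positivity)]
      exact growthRate_le_log_sphereCard_div S hn
  rw [← Real.exp_log hpos, ← Real.exp_nat_mul, ← Real.exp_add, Real.one_le_exp_iff]
  linarith

theorem tendsto_sphereCard_mul_pow (hS : Subgroup.closure S = ⊤) (hfin : S.Finite) {t : ℝ}
    (ht0 : 0 < t) (ht : t < Real.exp (-growthRate S)) :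
    Tendsto (fun n => sphereCard S n * t ^ n) atTop (𝓝 0) := by
  obtain ⟨M, hM, hMt⟩ := exists_between
    (lt_neg_of_lt_neg ((Real.log_lt_iff_lt_exp ht0).2 ht))
  have hlt : Real.exp M * t < 1 := by
    rw [← Real.exp_log ht0, ← Real.exp_add, Real.exp_lt_one_iff]
    linarith
  refine squeeze_zero' (.of_forall fun n => by positivity) ?_
    (tendsto_pow_atTop_nhds_zero_of_lt_one (by positivity) hlt)
  filter_upwards [(tendsto_log_sphereCard_div hS hfin).eventually_lt_const hM,
    eventually_gt_atTop 0] with n hn hn0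
  rw [div_lt_iff₀ (by positivity)] at hn
  rw [mul_pow, ← Real.exp_nat_mul, mul_comm (n : ℝ)]
  gcongr
  exact (Real.le_exp_log _).trans (Real.exp_le_exp.2 hn.le)

/-- The exponent `δ` with `α ^ δ = exp (-growthRate S)`, at which the growth series of the group
in the variable `α ^ δ` passes from divergence to convergence. -/
noncomputable def growthExponent (S : Set G) (α : ℝ) : ℝ≥0 :=
  (growthRate S / -Real.log α).toNNReal

theorem rpow_growthExponent (S : Set G) {α : ℝ} (hα0 : 0 < α) (hα1 : α < 1) :
    α ^ (growthExponent S α : ℝ) = Real.exp (-growthRate S) := by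
  have hlog : 0 < -Real.log α := neg_pos.2 (Real.log_neg hα0 hα1)
  rw [growthExponent, Real.coe_toNNReal _ (div_nonneg (growthRate_nonneg S) hlog.le),
    Real.rpow_def_of_pos hα0]
  congr 1
  field_simp [(Real.log_neg hα0 hα1).ne]

end Growth

section NormalForm

open Monoid

variable {ι : Type*} {Γ : ι → Type*} [∀ i, Group (Γ i)]

open Classical in
/-- The normal form of an element of the free product: the letters of the reduced word that
represents it. -/
noncomputable def letters (g : CoprodI Γ) : List (Σ i, Γ i) :=
  (CoprodI.Word.equiv g).toList

theorem prod_letters (g : CoprodI Γ) : ((letters g).map fun l => CoprodI.of l.2).prod = g := by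
  classical
  exact CoprodI.Word.equiv.left_inv g

theorem letters_injective : Function.Injective (letters : CoprodI Γ → List (Σ i, Γ i)) :=
  fun g h e => by rw [← prod_letters g, e, prod_letters]

theorem letters_prod {L : List (Σ i, Γ i)} (hL : ∀ l ∈ L, l.2 ≠ 1)
    (hc : L.IsChain fun l l' => l.1 ≠ l'.1) :
    letters (L.map fun l => CoprodI.of l.2).prod = L := by
  classical
  exact congrArg CoprodI.Word.toList (CoprodI.Word.equiv.right_inv ⟨L, hL, hc⟩)

theorem letters_inv (g : CoprodI Γ) :
    letters g⁻¹ = ((letters g).map fun l => ⟨l.1, l.2⁻¹⟩).reverse := by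
  classical
  have hprod : g⁻¹ = ((((letters g).map fun l => (⟨l.1, l.2⁻¹⟩ : Σ i, Γ i)).reverse).map
      fun l => CoprodI.of l.2).prod := by
    conv_lhs => rw [← prod_letters g, List.prod_inv_reverse]
    simp [Function.comp_def]
  conv_lhs => rw [hprod]
  refine letters_prod (fun l hl => ?_) ?_
  · obtain ⟨l', hl', rfl⟩ := List.mem_map.1 (List.mem_reverse.1 hl)
    exact inv_ne_one.2 ((CoprodI.Word.equiv g).ne_one l' hl')
  · rw [List.isChain_reverse, List.isChain_map]
    exact (CoprodI.Word.equiv g).chain_ne.imp fun _ _ => Ne.symm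

open Classical in
theorem exists_letters_of_mul (i : ι) (g : CoprodI Γ) : ∃ (y : Γ i) (L : List (Σ i, Γ i)),
    ∀ s : Γ i, letters (CoprodI.of s * g) = if s * y = 1 then L else ⟨i, s * y⟩ :: L := by
  let p := CoprodI.Word.equivPair i (CoprodI.Word.equiv g)
  refine ⟨p.head, p.tail.toList, fun s => ?_⟩
  have h : CoprodI.Word.equiv (CoprodI.of s * g) = CoprodI.of s • CoprodI.Word.equiv g := by
    rw [← Equiv.eq_symm_apply]
    change _ = (CoprodI.of s • CoprodI.Word.equiv g).prod
    rw [CoprodI.Word.prod_smul]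
    exact congrArg _ (CoprodI.Word.equiv.left_inv g).symm
  rw [letters, h, CoprodI.Word.of_smul_def, CoprodI.Word.rcons]
  split_ifs <;> rfl

open Classical in
theorem exists_letters_mul_of (i : ι) (g : CoprodI Γ) : ∃ (y : Γ i) (L : List (Σ i, Γ i)),
    ∀ s : Γ i, letters (g * CoprodI.of s) = if y * s = 1 then L else L ++ [⟨i, y * s⟩] := by
  obtain ⟨y, L, h⟩ := exists_letters_of_mul i g⁻¹
  refine ⟨y⁻¹, (L.map fun l => ⟨l.1, l.2⁻¹⟩).reverse, fun s => ?_⟩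
  have hiff : s⁻¹ * y = 1 ↔ y⁻¹ * s = 1 := by rw [← inv_eq_one, mul_inv_rev, inv_inv]
  rw [← inv_inv (g * CoprodI.of s), letters_inv, mul_inv_rev, ← map_inv, h]
  simp only [hiff]
  split_ifs <;> simp

end NormalForm

section FreeProductLength

open Monoid SimpleGraph

variable {ι : Type*} {Γ : ι → Type*} [∀ i, Group (Γ i)] {S : ∀ i, Set (Γ i)}

/-- The generating set of the free product formed by the generating sets of the factors, so that
`freeProductGraph S` is its Cayley graph. -/
def freeProductGenerators (S : ∀ i, Set (Γ i)) : Set (CoprodI Γ) :=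
  ⋃ i, CoprodI.of '' S i

theorem finite_freeProductGenerators [Finite ι] (hfin : ∀ i, (S i).Finite) :
    (freeProductGenerators S).Finite :=
  Set.finite_iUnion fun i => (hfin i).image _

variable (hgen : ∀ i, Subgroup.closure (S i) = ⊤)
include hgen

theorem closure_freeProductGenerators : Subgroup.closure (freeProductGenerators S) = ⊤ := by
  refine (Subgroup.eq_top_iff' _).2 fun g => ?_
  induction g using CoprodI.induction_on with
  | one => exact one_mem _
  | of i y =>
    have hle : (⊤ : Subgroup (Γ i)) ≤
        (Subgroup.closure (freeProductGenerators S)).comap CoprodI.of := by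
      rw [← hgen i, Subgroup.closure_le]
      exact fun s hs => Subgroup.subset_closure (Set.mem_iUnion.2 ⟨i, s, hs, rfl⟩)
    exact hle (Subgroup.mem_top y)
  | mul a b ha hb => exact mul_mem ha hb

theorem freeProductGraph_connected : (freeProductGraph S).Connected :=
  mulCayley_connected (closure_freeProductGenerators hgen)

theorem cayleyLength_of_le {i : ι} (y : Γ i) :
    cayleyLength (freeProductGenerators S) (CoprodI.of y) ≤ cayleyLength (S i) y := by
  have h := graphDist_map_le (mulCayley_connected (hgen i)) (factorCopy S i 1) 1 y
  rwa [show factorCopy S i 1 1 = 1 by simp [factorCopy],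
    show factorCopy S i 1 y = CoprodI.of y by simp [factorCopy]] at h

theorem sum_cayleyLength_letters_of_mul_le {i : ι} (s : Γ i) (g : CoprodI Γ) :
    ((letters (CoprodI.of s * g)).map fun l => cayleyLength (S l.1) l.2).sum ≤
      ((letters g).map fun l => cayleyLength (S l.1) l.2).sum + cayleyLength (S i) s := by
  classical
  obtain ⟨y, L, h⟩ := exists_letters_of_mul i g
  have hsum : ∀ z : Γ i, ((if z = 1 then L else ⟨i, z⟩ :: L).map
      fun l => cayleyLength (S l.1) l.2).sum =
        cayleyLength (S i) z + (L.map fun l => cayleyLength (S l.1) l.2).sum := by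
    intro z
    split_ifs with hz <;> simp [hz]
  have h1 := h 1
  rw [map_one, one_mul, one_mul] at h1
  rw [h, h1, hsum, hsum]
  have := cayleyLength_mul_le (hgen i) s y
  lia

theorem cayleyLength_freeProductGenerators (g : CoprodI Γ) :
    cayleyLength (freeProductGenerators S) g =
      ((letters g).map fun l => cayleyLength (S l.1) l.2).sum := by
  have hS := closure_freeProductGenerators hgen
  apply le_antisymm
  · conv_lhs => rw [← prod_letters g]
    induction letters g with
    | nil => simp
    | cons l L ih =>
      simp only [List.map_cons, List.prod_cons, List.sum_cons]
      exact (cayleyLength_mul_le hS _ _).trans (add_le_add (cayleyLength_of_le hgen l.2) ih)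
  · refine le_cayleyLength hS
      (f := fun g => ((letters g).map fun l => cayleyLength (S l.1) l.2).sum) ?_ ?_ ?_ g
    · have h1 : letters (1 : CoprodI Γ) = [] := letters_prod (L := []) (by simp) List.isChain_nil
      simp [h1]
    · intro _ ht g
      obtain ⟨i, s, hs, rfl⟩ := Set.mem_iUnion.1 ht
      exact (sum_cayleyLength_letters_of_mul_le hgen s g).trans
        (Nat.add_le_add_left (cayleyLength_le_one hs) _)
    · intro _ ht g
      obtain ⟨i, s, hs, rfl⟩ := Set.mem_iUnion.1 ht
      rw [← map_inv]
      refine (sum_cayleyLength_letters_of_mul_le hgen s⁻¹ g).trans (Nat.add_le_add_left ?_ _)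
      exact (cayleyLength_inv (hgen i) s).trans_le (cayleyLength_le_one hs)

theorem cayleyLength_of {i : ι} (y : Γ i) :
    cayleyLength (freeProductGenerators S) (CoprodI.of y) = cayleyLength (S i) y := by
  by_cases hy : y = 1
  · simp [hy]
  · have h : letters (CoprodI.of y) = [⟨i, y⟩] := by
      simpa using letters_prod (L := [⟨i, y⟩]) (by simpa using hy) (List.isChain_singleton _)
    simp [cayleyLength_freeProductGenerators hgen, h]

end FreeProductLength

section InfiniteWords

open Monoid SimpleGraph

variable {ι : Type*} {Γ : ι → Type*} [∀ i, Group (Γ i)] {S : ∀ i, Set (Γ i)}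
  {w v : ℕ → Σ i, Γ i} {m n : ℕ}

theorem wordPrefix_succ (w : ℕ → Σ i, Γ i) (n : ℕ) :
    wordPrefix w (n + 1) = wordPrefix w n * CoprodI.of (w n).2 := by
  simp [wordPrefix, List.range_succ]

theorem letters_wordPrefix (hw : IsInfiniteWord w) (n : ℕ) :
    letters (wordPrefix w n) = (List.range n).map w := by
  have h : wordPrefix w n = (((List.range n).map w).map fun l => CoprodI.of l.2).prod := by
    simp [wordPrefix, Function.comp_def]
  rw [h]
  refine letters_prod (by simpa using fun k _ => (hw k).1) ?_
  rw [List.isChain_map, List.isChain_range]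
  exact fun k _ => (hw k).2

theorem wordPrefix_injective (hw : IsInfiniteWord w) : Function.Injective (wordPrefix w) := by
  intro m n h
  simpa [letters_wordPrefix hw] using congrArg (fun g => (letters g).length) h

theorem cayleyLength_wordPrefix (hgen : ∀ i, Subgroup.closure (S i) = ⊤) (hw : IsInfiniteWord w)
    (n : ℕ) : cayleyLength (freeProductGenerators S) (wordPrefix w n) =
      ∑ k ∈ Finset.range n, cayleyLength (S (w k).1) (w k).2 := by
  rw [cayleyLength_freeProductGenerators hgen, letters_wordPrefix hw, List.map_map]
  rfl

theorem exists_graphRay_wordPrefix (hgen : ∀ i, Subgroup.closure (S i) = ⊤)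
    (hw : IsInfiniteWord w) :
    ∃ ρ : GraphRay (freeProductGraph S), ∀ n, wordPrefix w n ∈ Set.range ρ.vertex := by
  have hS := closure_freeProductGenerators hgen
  refine exists_graphRay_of_graphDist_eq_add (freeProductGraph_connected hgen)
    (fun n h => by simpa using wordPrefix_injective hw h) fun n => ?_
  have hstep : (freeProductGraph S).dist (wordPrefix w n) (wordPrefix w (n + 1)) =
      cayleyLength (S (w n).1) (w n).2 := by
    rw [freeProductGraph, ← freeProductGenerators, ← cayleyLength_inv_mul hS, wordPrefix_succ,
      inv_mul_cancel_left, cayleyLength_of hgen]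
  have h0 : ∀ k, (freeProductGraph S).dist (wordPrefix w 0) (wordPrefix w k) =
      ∑ j ∈ Finset.range k, cayleyLength (S (w j).1) (w j).2 := fun k => by
    rw [← cayleyLength_wordPrefix hgen hw]
    rfl
  rw [hstep, h0, h0, Finset.sum_range_succ]

theorem letters_prefix_letters_mul_of {q g : CoprodI Γ} (hqg : letters q <+: letters g)
    (hne : g ≠ q) {i : ι} (s : Γ i) : letters q <+: letters (g * CoprodI.of s) := by
  classical
  obtain ⟨y, L, hL⟩ := exists_letters_mul_of i g
  have h1 := hL 1
  rw [map_one, mul_one, mul_one] at h1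
  have hne' : letters q ≠ letters g := fun h => hne (letters_injective h).symm
  have hqL : letters q <+: L := by
    rw [h1] at hqg hne'
    split_ifs at hqg hne'
    · exact hqg
    · exact (List.prefix_concat_iff.1 hqg).resolve_left hne'
  rw [hL]
  split_ifs
  exacts [hqL, hqL.trans (List.prefix_append _ _)]

/-- A path can leave the set of elements whose normal form begins with that of `q` only through
`q` itself. -/
theorem letters_prefix_of_mem_componentCompl {K : Set (CoprodI Γ)} {q g h : CoprodI Γ}
    (hq : q ∈ K) {C : (freeProductGraph S).ComponentCompl K} (hg : g ∈ C) (hh : h ∈ C)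
    (hqg : letters q <+: letters g) : letters q <+: letters h := by
  have walk : ∀ {a b : (Kᶜ : Set (CoprodI Γ))} (_ : ((freeProductGraph S).induce Kᶜ).Walk a b),
      letters q <+: letters (a : CoprodI Γ) → letters q <+: letters (b : CoprodI Γ) := by
    intro a b p
    induction p with
    | nil => exact id
    | @cons a b _ hadj _ ih =>
      intro ha
      refine ih ?_
      have hne : (a : CoprodI Γ) ≠ q := fun h => a.2 (h ▸ hq)
      obtain ⟨-, t, ht, h | h⟩ := (mulCayley_adj' _ (a : CoprodI Γ) b).1 hadj <;>
        obtain ⟨i, s, -, rfl⟩ := Set.mem_iUnion.1 ht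
      · exact h ▸ letters_prefix_letters_mul_of ha hne s
      · rw [eq_mul_inv_of_mul_eq h.symm, ← map_inv]
        exact letters_prefix_letters_mul_of ha hne s⁻¹
  obtain ⟨hgK, rfl⟩ := hg
  obtain ⟨hhK, hh⟩ := hh
  obtain ⟨p⟩ := ConnectedComponent.exact hh.symm
  exact walk p hqg

theorem exists_le_wordPrefix_mem (hw : IsInfiniteWord w) {ρ : GraphRay (freeProductGraph S)}
    (hρ : ∀ n, wordPrefix w n ∈ Set.range ρ.vertex) {A : Set (CoprodI Γ)}
    (hA : ρ.toEnd.ContainedIn A) (n : ℕ) : ∃ N, n ≤ N ∧ wordPrefix w N ∈ A := by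
  choose t ht using hρ
  have htinj : Function.Injective t := fun a b hab =>
    wordPrefix_injective hw (by rw [← ht a, ← ht b, hab])
  obtain ⟨N, hN⟩ := ((htinj.nat_tendsto_atTop.eventually hA.eventually_mem).and
    (Filter.eventually_ge_atTop n)).exists
  exact ⟨N, hN.2, ht N ▸ hN.1⟩

theorem eq_of_sameComponent (hgen : ∀ i, Subgroup.closure (S i) = ⊤) (hw : IsInfiniteWord w)
    (hv : IsInfiniteWord v) {ρ σ : GraphRay (freeProductGraph S)}
    (hρ : ∀ n, wordPrefix w n ∈ Set.range ρ.vertex)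
    (hσ : ∀ n, wordPrefix v n ∈ Set.range σ.vertex)
    (hm : ∑ k ∈ Finset.range n, cayleyLength (S (w k).1) (w k).2 < m)
    (h : GraphEnd.SameComponent 1 m ρ.toEnd σ.toEnd) : ∀ k < n, v k = w k := by
  obtain ⟨C, hρC, hσC⟩ := h
  obtain ⟨M, hnM, hMC⟩ := exists_le_wordPrefix_mem hw hρ hρC n
  obtain ⟨N, hnN, hNC⟩ := exists_le_wordPrefix_mem hv hσ hσC n
  have hpre : ∀ (u : ℕ → Σ i, Γ i) {N : ℕ}, n ≤ N →
      (List.range n).map u <+: (List.range N).map u := by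
    intro u N h
    obtain ⟨d, rfl⟩ := Nat.exists_eq_add_of_le h
    rw [List.range_add, List.map_append]
    exact List.prefix_append _ _
  have hball : wordPrefix w n ∈ {g | (freeProductGraph S).dist 1 g < m} := by
    rw [← cayleyLength_wordPrefix hgen hw] at hm
    exact hm
  have hwv := letters_prefix_of_mem_componentCompl hball hMC hNC
    (by simpa only [letters_wordPrefix hw] using hpre w hnM)
  rw [letters_wordPrefix hw, letters_wordPrefix hv] at hwv
  have heq := (List.prefix_of_prefix_length_le (hpre v hnN) hwv (by simp)).eq_of_length (by simp)
  exact fun k hk => List.map_inj_left.1 heq k (by simpa using hk)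

end InfiniteWords

section BallCovers

open MeasureTheory

variable {X : Type*} {d : X → X → ℝ} {δ : ℝ≥0} {A : Set X}

theorem ballHausdorffMeasure_eq_zero_of_countable_cover {κ : Type*} [Countable κ]
    {B : κ → Set X} (hA : A ⊆ ⋃ k, B k)
    (h : ∀ k, ∀ ε : ℝ, 0 < ε → ∀ η : ℝ≥0∞, η ≠ 0 → ∃ r : ℝ, 0 < r ∧ r < ε ∧ ∃ F ⊆ A,
      F.Countable ∧ F.encard * ENNReal.ofReal r ^ (δ : ℝ) ≤ η ∧ ∀ x ∈ B k, ∃ c ∈ F, d c x ≤ r) :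
    ballHausdorffMeasure d δ A = 0 := by
  simp only [ballHausdorffMeasure, ENNReal.iSup_eq_zero]
  intro ε hε
  refine le_antisymm (ENNReal.le_of_forall_pos_le_add fun η hη _ => ?_) bot_le
  obtain ⟨η', hη', hsum⟩ := ENNReal.exists_pos_sum_of_countable'
    (ENNReal.coe_ne_zero.2 hη.ne') κ
  choose r hr0 hrε F hFA hFc hF hcov using fun k => h k ε hε (η' k) (hη' k).ne'
  have hT : IsBallCover d A ε (⋃ k, F k ×ˢ {r k}) := by
    refine ⟨Set.countable_iUnion fun k => (hFc k).prod (Set.countable_singleton _), ?_, ?_⟩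
    · rintro ⟨c, s⟩ hp
      obtain ⟨k, hc, hs⟩ := Set.mem_iUnion.1 hp
      obtain rfl : s = r k := hs
      exact ⟨hFA k hc, hr0 k, hrε k⟩
    · intro x hx
      obtain ⟨k, hk⟩ := Set.mem_iUnion.1 (hA hx)
      obtain ⟨c, hc, hcx⟩ := hcov k x hk
      exact Set.mem_biUnion (x := (c, r k)) (Set.mem_iUnion.2 ⟨k, hc, rfl⟩) hcx
  refine (iInf₂_le _ hT).trans ?_
  rw [zero_add]
  refine (ENNReal.tsum_iUnion_le_tsum
    (fun p : X × ℝ => ENNReal.ofReal p.2 ^ (δ : ℝ)) _).trans ?_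
  refine (ENNReal.tsum_le_tsum fun k => ?_).trans hsum.le
  refine le_trans (le_of_eq ?_) (hF k)
  have hconst : ∀ p : (F k ×ˢ {r k} : Set (X × ℝ)),
      ENNReal.ofReal p.1.2 ^ (δ : ℝ) = ENNReal.ofReal (r k) ^ (δ : ℝ) := by
    rintro ⟨⟨c, s⟩, -, hs⟩
    obtain rfl : s = r k := hs
    rfl
  rw [tsum_congr hconst, ENNReal.tsum_set_const, Set.encard_prod, Set.encard_singleton, mul_one]

/-- The mass distribution principle. -/
theorem ballHausdorffMeasure_ne_zero_of_measure_le {Y : Type*} [MeasurableSpace Y] {μ : Measure Y}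
    (hμ : μ ≠ 0) {F : Y → X} (hF : ∀ y, F y ∈ A) {c : ℝ≥0∞} (hc : c ≠ 0)
    (hball : ∀ x ∈ A, ∀ ε : ℝ, 0 < ε → ε < 1 →
      c * μ {y | d x (F y) ≤ ε} ≤ ENNReal.ofReal ε ^ (δ : ℝ)) :
    ballHausdorffMeasure d δ A ≠ 0 := by
  have hpos : c * μ Set.univ ≠ 0 := mul_ne_zero hc (Measure.measure_univ_ne_zero.2 hμ)
  refine ne_of_gt ((pos_iff_ne_zero.2 hpos).trans_le ?_)
  refine le_trans ?_ (le_iSup₂ (1 : ℝ) zero_lt_one)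
  refine le_iInf₂ fun T ⟨hTc, hT, hcov⟩ => ?_
  have huniv : (Set.univ : Set Y) ⊆ ⋃ p ∈ T, {y | d p.1 (F y) ≤ p.2} := fun y _ => by
    simpa using hcov (hF y)
  calc c * μ Set.univ ≤ c * ∑' p : T, μ {y | d p.1.1 (F y) ≤ p.1.2} := by
        gcongr
        exact (measure_mono huniv).trans (measure_biUnion_le μ hTc _)
    _ = ∑' p : T, c * μ {y | d p.1.1 (F y) ≤ p.1.2} := ENNReal.tsum_mul_left.symm
    _ ≤ ∑' p : T, ENNReal.ofReal p.1.2 ^ (δ : ℝ) :=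
        ENNReal.tsum_le_tsum fun p => hball _ (hT p p.2).1 _ (hT p p.2).2.1 (hT p p.2).2.2

end BallCovers

section Coding

open MeasureTheory Filter

variable {X B : Type*} {d : X → X → ℝ} {δ : ℝ≥0} {A : Set X}

/-- The witness is the Bernoulli measure with the weights `a`, normalized. -/
theorem exists_probabilityMeasure_cylinder_le [Fintype B] [MeasurableSpace B]
    [MeasurableSingletonClass B] {a : B → ℝ} (ha : ∀ b, 0 ≤ a b) (hsum : 1 ≤ ∑ b, a b) :
    ∃ μ : Measure (ℕ → B), IsProbabilityMeasure μ ∧ ∀ (b : ℕ → B) (n : ℕ),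
      μ {b' | ∀ k < n, b' k = b k} ≤ ENNReal.ofReal (∏ k ∈ Finset.range n, a (b k)) := by
  have hs : 0 < ∑ b, a b := zero_lt_one.trans_le hsum
  let q : PMF B := PMF.ofFintype (fun b => ENNReal.ofReal (a b / ∑ b, a b)) (by
    rw [← ENNReal.ofReal_sum_of_nonneg fun b _ => div_nonneg (ha b) hs.le, ← Finset.sum_div,
      div_self hs.ne', ENNReal.ofReal_one])
  refine ⟨Measure.infinitePi fun _ => q.toMeasure, inferInstance, fun b n => ?_⟩
  have hcyl : {b' : ℕ → B | ∀ k < n, b' k = b k} =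
      Set.pi (Finset.range n) fun k => ({b k} : Set B) := by
    ext b'
    simp
  rw [hcyl, Measure.infinitePi_pi _ fun k _ => measurableSet_singleton _,
    ENNReal.ofReal_prod_of_nonneg fun k _ => ha _]
  refine Finset.prod_le_prod' fun k _ => ?_
  rw [PMF.toMeasure_apply_singleton _ _ (measurableSet_singleton _)]
  exact ENNReal.ofReal_le_ofReal (div_le_self (ha _) hsum)

theorem ofReal_pow_rpow {α : ℝ} (hα : 0 < α) (δ : ℝ) (n : ℕ) :
    ENNReal.ofReal (α ^ n) ^ δ = ENNReal.ofReal ((α ^ δ) ^ n) := by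
  rw [ENNReal.ofReal_rpow_of_pos (pow_pos hα n), ← Real.rpow_natCast_mul hα.le, mul_comm,
    Real.rpow_mul_natCast hα.le]

theorem exists_sum_range_le_lt_succ {f : ℕ → ℕ} (hf : ∀ k, 0 < f k) (m : ℕ) :
    ∃ n, ∑ k ∈ Finset.range n, f k ≤ m ∧ m < ∑ k ∈ Finset.range (n + 1), f k := by
  have hgrow : ∀ n, n ≤ ∑ k ∈ Finset.range n, f k := fun n => by
    simpa using Finset.card_nsmul_le_sum (Finset.range n) f 1 fun k _ => hf k
  obtain ⟨n, hn, hn'⟩ := Nat.exists_not_and_succ_of_not_zero_of_exists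
    (p := fun n => m < ∑ k ∈ Finset.range n, f k) (by simp) ⟨m + 1, hgrow (m + 1)⟩
  exact ⟨n, not_lt.1 hn, hn'⟩

theorem exists_pow_succ_le_lt_pow {α ε : ℝ} (hα0 : 0 ≤ α) (hα1 : α < 1) (hε0 : 0 < ε)
    (hε1 : ε < 1) : ∃ m : ℕ, α ^ (m + 1) ≤ ε ∧ ε < α ^ m := by
  obtain ⟨m, hm, hm'⟩ := Nat.exists_not_and_succ_of_not_zero_of_exists
    (p := fun m : ℕ => α ^ m ≤ ε) (by simpa using hε1)
    ((tendsto_pow_atTop_nhds_zero_of_lt_one hα0 hα1).eventually_le_const hε0).exists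
  exact ⟨m, hm', not_le.1 hm⟩

/-- A ball of radius about `α ^ m` meets only one cylinder of total length about `m`, and the
Bernoulli measure of that cylinder is at most about `(α ^ δ) ^ m`. -/
theorem ballHausdorffMeasure_ne_zero_of_coding [Fintype B] {α : ℝ} (hα0 : 0 < α) (hα1 : α < 1)
    {len : B → ℕ} (hlen : ∀ b, 0 < len b) (hsum : 1 ≤ ∑ b, (α ^ (δ : ℝ)) ^ len b)
    {F : (ℕ → B) → X} (hF : ∀ b, F b ∈ A)
    (hsep : ∀ c ∈ A, ∀ m b b', d c (F b) < α ^ m → d c (F b') < α ^ m →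
      ∀ n, ∑ k ∈ Finset.range n, len (b k) ≤ m → ∀ k < n, b' k = b k) :
    ballHausdorffMeasure d δ A ≠ 0 := by
  let : MeasurableSpace B := ⊤
  have : MeasurableSingletonClass B := ⟨fun _ => trivial⟩
  set t := α ^ (δ : ℝ)
  have ht0 : 0 < t := Real.rpow_pos_of_pos hα0 _
  have ht1 : t ≤ 1 := Real.rpow_le_one hα0.le hα1.le δ.2
  obtain ⟨μ, hμ, hcyl⟩ := exists_probabilityMeasure_cylinder_le
    (a := fun b => t ^ len b) (fun b => (pow_pos ht0 _).le) hsum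
  set L := ∑ b, len b
  refine ballHausdorffMeasure_ne_zero_of_measure_le (IsProbabilityMeasure.ne_zero μ) hF
    (ENNReal.ofReal_pos.2 (pow_pos ht0 L)).ne' fun c hc ε hε0 hε1 => ?_
  obtain hE | ⟨b, hb⟩ := {b | d c (F b) ≤ ε}.eq_empty_or_nonempty
  · simp [hE]
  obtain ⟨m, hmε, hεm⟩ := exists_pow_succ_le_lt_pow hα0.le hα1 hε0 hε1
  obtain ⟨n, hnm, hmn⟩ := exists_sum_range_le_lt_succ (fun k => hlen (b k)) m
  have hnL : m + 1 ≤ L + ∑ k ∈ Finset.range n, len (b k) := by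
    rw [Finset.sum_range_succ] at hmn
    have : len (b n) ≤ L := Finset.single_le_sum (f := len) (fun _ _ => Nat.zero_le _)
      (Finset.mem_univ (b n))
    lia
  have hsub : {b' | d c (F b') ≤ ε} ⊆ {b' | ∀ k < n, b' k = b k} := fun b' hb' =>
    hsep c hc m b b' (hb.trans_lt hεm) (lt_of_le_of_lt hb' hεm) n hnm
  calc ENNReal.ofReal (t ^ L) * μ {b | d c (F b) ≤ ε}
      ≤ ENNReal.ofReal (t ^ L) * ENNReal.ofReal (∏ k ∈ Finset.range n, t ^ len (b k)) := by
        gcongr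
        exact (measure_mono hsub).trans (hcyl b n)
    _ = ENNReal.ofReal (t ^ (L + ∑ k ∈ Finset.range n, len (b k))) := by
        rw [← ENNReal.ofReal_mul (by positivity), Finset.prod_pow_eq_pow_sum, pow_add]
    _ ≤ ENNReal.ofReal (t ^ (m + 1)) :=
        ENNReal.ofReal_le_ofReal (pow_le_pow_of_le_one ht0.le ht1 hnL)
    _ = ENNReal.ofReal (α ^ (m + 1)) ^ (δ : ℝ) := (ofReal_pow_rpow hα0 _ _).symm
    _ ≤ ENNReal.ofReal ε ^ (δ : ℝ) := by gcongr

end Coding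

section FactorEnds

open Monoid SimpleGraph Filter Topology

variable {ι : Type*} {Γ : ι → Type*} [∀ i, Group (Γ i)] [Finite ι] {S : ∀ i, Set (Γ i)} {α : ℝ}
  (hfin : ∀ i, (S i).Finite) (hgen : ∀ i, Subgroup.closure (S i) = ⊤) (hα0 : 0 < α) (hα1 : α < 1)
include hfin hgen hα0 hα1

theorem exists_endDist_factorCopy_le (i : ι) (x : CoprodI Γ) (k : ℕ) :
    ∃ F ⊆ factorEnds S i,
      F.encard ≤ sphereCard (S i) (k + cayleyLength (freeProductGenerators S) x) ∧
      ∀ ξ : GraphEnd (mulCayley (S i)), ∃ c ∈ F, GraphEnd.endDist 1 α c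
        (ξ.map (factorCopy S i x) (factorCopy_injective S i x)) ≤ α ^ k := by
  have hS := closure_freeProductGenerators hgen
  set m := k + cayleyLength (freeProductGenerators S) x
  obtain ⟨F, hF, hcov⟩ := GraphEnd.exists_encard_le_forall_sameComponent
    (mulCayley_connected (hgen i)) (finite_setOf_cayleyLength_lt (hgen i) (hfin i) m)
  refine ⟨(GraphEnd.map (factorCopy S i x) (factorCopy_injective S i x)) '' F, ?_, ?_, fun ξ => ?_⟩
  · rintro _ ⟨ξ, -, rfl⟩
    exact ⟨x, ξ, rfl⟩
  · rw [sphereCard, (finite_setOf_cayleyLength_eq (hgen i) (hfin i) m).cast_ncard_eq]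
    exact (Set.encard_image_le _ _).trans hF
  · obtain ⟨c, hcF, hc⟩ := hcov ξ
    refine ⟨_, ⟨c, hcF, rfl⟩, GraphEnd.endDist_le_pow hα0 hα1 (hc.map _ ?_ fun y hy => ?_)⟩
    · exact finite_setOf_cayleyLength_lt hS (finite_freeProductGenerators hfin) k
    · change cayleyLength (freeProductGenerators S) (x * CoprodI.of y) < k at hy
      have h := cayleyLength_mul_le hS x⁻¹ (x * CoprodI.of y)
      rw [inv_mul_cancel_left, cayleyLength_of hgen, cayleyLength_inv hS] at h
      change cayleyLength (S i) y < m
      lia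

theorem ballHausdorffMeasure_factorEnds_eq_zero {i : ι} {δ : ℝ≥0}
    (h : Tendsto (fun m : ℕ => (sphereCard (S i) m : ℝ) * (α ^ (δ : ℝ)) ^ m) atTop (𝓝 0)) :
    ballHausdorffMeasure (GraphEnd.endDist 1 α) δ (factorEnds S i) = 0 := by
  have := countable_of_closure_eq_top (closure_freeProductGenerators hgen)
    (finite_freeProductGenerators hfin)
  refine ballHausdorffMeasure_eq_zero_of_countable_cover
    (B := fun x : CoprodI Γ => Set.range fun ξ : GraphEnd (mulCayley (S i)) =>
      ξ.map (factorCopy S i x) (factorCopy_injective S i x)) ?_ fun x ε hε η hη => ?_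
  · rintro _ ⟨x, ξ, rfl⟩
    exact Set.mem_iUnion.2 ⟨x, ξ, rfl⟩
  set l := cayleyLength (freeProductGenerators S) x
  set t := α ^ (δ : ℝ)
  have ht0 : 0 < t := Real.rpow_pos_of_pos hα0 _
  have hshift : Tendsto (fun k : ℕ => (sphereCard (S i) (k + l) : ℝ) * t ^ k) atTop (𝓝 0) := by
    have := ((tendsto_add_atTop_iff_nat l).2 h).mul_const (t ^ l)⁻¹
    rw [zero_mul] at this
    refine this.congr fun k => ?_
    rw [pow_add, ← mul_assoc, mul_inv_cancel_right₀ (pow_ne_zero _ ht0.ne')]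
  have hsmall := ENNReal.tendsto_ofReal hshift
  rw [ENNReal.ofReal_zero] at hsmall
  obtain ⟨k, hkη, hkε⟩ := ((hsmall.eventually_le_const (pos_iff_ne_zero.2 hη)).and
    ((tendsto_pow_atTop_nhds_zero_of_lt_one hα0.le hα1).eventually_lt_const hε)).exists
  obtain ⟨F, hFA, hF, hcov⟩ := exists_endDist_factorCopy_le hfin hgen hα0 hα1 i x k
  refine ⟨α ^ k, by positivity, hkε, F, hFA, (Set.finite_of_encard_le_coe hF).countable, ?_, ?_⟩
  · refine le_trans ?_ hkη
    rw [ENNReal.ofReal_mul (Nat.cast_nonneg _), ENNReal.ofReal_natCast, ofReal_pow_rpow hα0]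
    gcongr
    exact_mod_cast hF
  · rintro _ ⟨ξ, rfl⟩
    exact hcov ξ

theorem endHausdorffDim_factorEnds_le (i : ι) :
    endHausdorffDim S α (factorEnds S i) ≤ growthExponent (S i) α := by
  refine le_of_forall_gt_imp_ge_of_dense fun c hc => ?_
  obtain ⟨δ, hδ, hδc⟩ := ENNReal.lt_iff_exists_nnreal_btwn.1 hc
  refine le_trans (iInf₂_le δ ?_) hδc.le
  refine ballHausdorffMeasure_factorEnds_eq_zero hfin hgen hα0 hα1
    (tendsto_sphereCard_mul_pow (hgen i) (hfin i) (Real.rpow_pos_of_pos hα0 _) ?_)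
  rw [← rpow_growthExponent (S i) hα0 hα1]
  exact Real.rpow_lt_rpow_of_exponent_gt hα0 hα1 (by exact_mod_cast hδ)

end FactorEnds

section WordEnds

open Monoid Filter

variable {ι : Type*} {Γ : ι → Type*} {i : ι} {T : Finset (Γ i)} {Y : Finset (Σ k, Γ k)}

/-- The infinite word with the letters of `T` at the even and those of `Y` at the odd positions;
it codes the sequences of pairs by ends of the free product. -/
def alternatingWord (b : ℕ → T × Y) (n : ℕ) : Σ k, Γ k :=
  if n % 2 = 0 then ⟨i, (b (n / 2)).1⟩ else (b (n / 2)).2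

theorem alternatingWord_two_mul (b : ℕ → T × Y) (n : ℕ) :
    alternatingWord b (2 * n) = ⟨i, (b n).1⟩ := by
  simp [alternatingWord]

theorem alternatingWord_two_mul_add_one (b : ℕ → T × Y) (n : ℕ) :
    alternatingWord b (2 * n + 1) = (b n).2 := by
  have : (2 * n + 1) / 2 = n := by lia
  simp [alternatingWord, this]

theorem sum_range_two_mul_alternatingWord {M : Type*} [AddCommMonoid M] (f : (Σ k, Γ k) → M)
    (b : ℕ → T × Y) (n : ℕ) :
    ∑ k ∈ Finset.range (2 * n), f (alternatingWord b k) =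
      ∑ k ∈ Finset.range n, (f ⟨i, (b k).1⟩ + f (b k).2) := by
  induction n with
  | zero => simp
  | succ n ih =>
    rw [mul_add_one, Finset.sum_range_succ, Finset.sum_range_succ, ih, Finset.sum_range_succ _ n,
      alternatingWord_two_mul, alternatingWord_two_mul_add_one, add_assoc]

variable [∀ i, Group (Γ i)]

theorem isInfiniteWord_alternatingWord (hT : ∀ x ∈ T, x ≠ 1) (hY : ∀ y ∈ Y, y.2 ≠ 1 ∧ y.1 ≠ i)
    (b : ℕ → T × Y) : IsInfiniteWord (alternatingWord b) := by
  intro n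
  obtain ⟨k, rfl | rfl⟩ := n.even_or_odd'
  · rw [alternatingWord_two_mul, alternatingWord_two_mul_add_one]
    exact ⟨hT _ (b k).1.2, (hY _ (b k).2.2).2.symm⟩
  · rw [alternatingWord_two_mul_add_one, show 2 * k + 1 + 1 = 2 * (k + 1) by lia,
      alternatingWord_two_mul]
    exact hY _ (b k).2.2

variable {S : ∀ i, Set (Γ i)} {α : ℝ}

theorem ballHausdorffMeasure_infiniteWordEnds_ne_zero (hgen : ∀ i, Subgroup.closure (S i) = ⊤)
    (hα0 : 0 < α) (hα1 : α < 1) {δ : ℝ≥0}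
    (hT : ∀ x ∈ T, x ≠ 1) (hY : ∀ y ∈ Y, y.2 ≠ 1 ∧ y.1 ≠ i)
    (hsum : 1 ≤ (∑ x ∈ T, (α ^ (δ : ℝ)) ^ cayleyLength (S i) x) *
      ∑ y ∈ Y, (α ^ (δ : ℝ)) ^ cayleyLength (S y.1) y.2) :
    ballHausdorffMeasure (GraphEnd.endDist 1 α) δ (infiniteWordEnds S) ≠ 0 := by
  have hword := isInfiniteWord_alternatingWord hT hY
  choose ρ hρ using fun b : ℕ → T × Y => exists_graphRay_wordPrefix hgen (hword b)
  refine ballHausdorffMeasure_ne_zero_of_coding hα0 hα1 (B := T × Y)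
    (len := fun b => cayleyLength (S i) b.1 + cayleyLength (S b.2.1.1) b.2.1.2)
    (fun b => Nat.add_pos_left (cayleyLength_pos (hgen i) (hT _ b.1.2)) _) ?_
    (F := fun b => (ρ b).toEnd) (fun b => ⟨_, hword b, ρ b, rfl, hρ b⟩) ?_
  · rw [← Finset.sum_coe_sort T, ← Finset.sum_coe_sort Y, Finset.sum_mul_sum,
      ← Fintype.sum_prod_type'] at hsum
    simpa only [pow_add] using hsum
  · intro c _ m b b' hb hb' n hn k hk
    have hsame := (GraphEnd.sameComponent_of_endDist_lt hα0 hα1 hb).symm.trans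
      (GraphEnd.sameComponent_of_endDist_lt hα0 hα1 hb')
    have hagree := eq_of_sameComponent hgen (hword b) (hword b') (hρ b) (hρ b') (n := 2 * n)
      (by rw [sum_range_two_mul_alternatingWord fun l => cayleyLength (S l.1) l.2]; lia) hsame
    have heven := hagree (2 * k) (by lia)
    have hodd := hagree (2 * k + 1) (by lia)
    simp only [alternatingWord_two_mul, Sigma.mk.injEq, heq_eq_eq, true_and] at heven
    simp only [alternatingWord_two_mul_add_one] at hodd
    exact Prod.ext (Subtype.ext heven) (Subtype.ext hodd)

theorem lt_endHausdorffDim_infiniteWordEnds (hgen : ∀ i, Subgroup.closure (S i) = ⊤)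
    (hα0 : 0 < α) (hα1 : α < 1) {c : ℝ≥0}
    (hT : ∀ x ∈ T, x ≠ 1) (hY : ∀ y ∈ Y, y.2 ≠ 1 ∧ y.1 ≠ i)
    (hsum : 1 < (∑ x ∈ T, (α ^ (c : ℝ)) ^ cayleyLength (S i) x) *
      ∑ y ∈ Y, (α ^ (c : ℝ)) ^ cayleyLength (S y.1) y.2) :
    (c : ℝ≥0∞) < endHausdorffDim S α (infiniteWordEnds S) := by
  have hcont : Continuous fun δ : ℝ≥0 => (∑ x ∈ T, (α ^ (δ : ℝ)) ^ cayleyLength (S i) x) *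
      ∑ y ∈ Y, (α ^ (δ : ℝ)) ^ cayleyLength (S y.1) y.2 := by
    have : Continuous fun δ : ℝ≥0 => α ^ (δ : ℝ) :=
      (Real.continuous_const_rpow hα0.ne').comp NNReal.continuous_coe
    fun_prop
  obtain ⟨δ, hδ, hcδ⟩ := ((((hcont.tendsto c).eventually_const_lt hsum).filter_mono
    nhdsWithin_le_nhds).and (eventually_mem_nhdsWithin (s := Set.Ioi c))).exists
  have hcδ' : (c : ℝ≥0∞) < δ := by exact_mod_cast hcδ
  refine hcδ'.trans_le (le_iInf₂ fun d hd => ?_)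
  by_contra! hdδ
  have hle : α ^ (δ : ℝ) ≤ α ^ (d : ℝ) :=
    Real.rpow_le_rpow_of_exponent_ge hα0 hα1.le (by exact_mod_cast hdδ.le)
  refine ballHausdorffMeasure_infiniteWordEnds_ne_zero hgen hα0 hα1 hT hY (hδ.le.trans ?_) hd
  gcongr

end WordEnds

section Letters

variable {ι : Type*} {Γ : ι → Type*} [∀ i, Group (Γ i)] [∀ i, Nontrivial (Γ i)]

theorem natCard_eq_two_of_forall_ne_one_eq {G : Type*} [Group G] [Nontrivial G]
    (h : ∀ x y : G, x ≠ 1 → y ≠ 1 → x = y) : Nat.card G = 2 := by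
  obtain ⟨g, hg⟩ := exists_ne (1 : G)
  exact Nat.card_eq_two_iff.2 ⟨1, g, hg.symm, Set.eq_univ_of_forall fun x =>
    or_iff_not_imp_left.2 fun hx => h x g hx hg⟩

theorem exists_pair_of_letters [Fintype ι] [Nontrivial ι]
    (hΓ : ¬ (Fintype.card ι = 2 ∧ ∀ i, Nat.card (Γ i) = 2)) (i : ι) :
    (∃ x y : Γ i, x ≠ 1 ∧ y ≠ 1 ∧ x ≠ y) ∨
      ∃ x y : Σ k, Γ k, (x.2 ≠ 1 ∧ x.1 ≠ i) ∧ (y.2 ≠ 1 ∧ y.1 ≠ i) ∧ x ≠ y := by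
  by_contra! ⟨hi, hother⟩
  obtain ⟨j, hj⟩ := exists_ne i
  have hjk : ∀ k, k ≠ i → k = j := fun k hk => by
    obtain ⟨a, ha⟩ := exists_ne (1 : Γ k)
    obtain ⟨b, hb⟩ := exists_ne (1 : Γ j)
    exact congrArg Sigma.fst (hother ⟨k, a⟩ ⟨j, b⟩ ⟨ha, hk⟩ ⟨hb, hj⟩)
  refine hΓ ⟨?_, fun k => natCard_eq_two_of_forall_ne_one_eq fun a b ha hb => ?_⟩
  · rw [← Nat.card_eq_fintype_card]
    exact Nat.card_eq_two_iff.2 ⟨i, j, hj.symm, Set.eq_univ_of_forall fun k =>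
      or_iff_not_imp_left.2 (hjk k)⟩
  · obtain rfl | hk := eq_or_ne k i
    · exact hi a b ha hb
    · simpa using hother ⟨k, a⟩ ⟨k, b⟩ ⟨ha, hk⟩ ⟨hb, hk⟩

theorem exists_finset_letters_one_lt_card_mul_card [Fintype ι] [Nontrivial ι]
    (hΓ : ¬ (Fintype.card ι = 2 ∧ ∀ i, Nat.card (Γ i) = 2)) (i : ι) :
    ∃ (T : Finset (Γ i)) (Y : Finset (Σ k, Γ k)), (∀ x ∈ T, x ≠ 1) ∧
      (∀ y ∈ Y, y.2 ≠ 1 ∧ y.1 ≠ i) ∧ 1 < T.card * Y.card := by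
  classical
  obtain ⟨x, y, hx, hy, hxy⟩ | ⟨x, y, hx, hy, hxy⟩ := exists_pair_of_letters hΓ i
  · obtain ⟨j, hj⟩ := exists_ne i
    obtain ⟨b, hb⟩ := exists_ne (1 : Γ j)
    exact ⟨{x, y}, {⟨j, b⟩}, by simp [hx, hy], by simp [hb, hj], by simp [hxy]⟩
  · obtain ⟨a, ha⟩ := exists_ne (1 : Γ i)
    refine ⟨{a}, {x, y}, by simp [ha], fun z hz => ?_, by simp [hxy]⟩
    obtain rfl | rfl := (Finset.mem_insert.1 hz).imp_right Finset.mem_singleton.1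
    exacts [hx, hy]

/-- At the critical exponent the terms of the growth series of an infinite group are at least one,
so that the series diverges. -/
theorem exists_finset_le_sum_exp_pow_cayleyLength {G : Type*} [Group G] [Infinite G] {S : Set G}
    (hS : Subgroup.closure S = ⊤) (hfin : S.Finite) (N : ℕ) :
    ∃ T : Finset G, (∀ x ∈ T, x ≠ 1) ∧
      (N : ℝ) ≤ ∑ x ∈ T, Real.exp (-growthRate S) ^ cayleyLength S x := by
  classical
  let sphere m := (finite_setOf_cayleyLength_eq hS hfin m).toFinset
  have mem_sphere {m x} : x ∈ sphere m ↔ cayleyLength S x = m := by simp [sphere]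
  refine ⟨(Finset.Icc 1 N).biUnion sphere, fun x hx => ?_, ?_⟩
  · rintro rfl
    obtain ⟨m, hm, h1⟩ := Finset.mem_biUnion.1 hx
    rw [mem_sphere, cayleyLength_one] at h1
    exact absurd (Finset.mem_Icc.1 hm).1 (by lia)
  rw [Finset.sum_biUnion fun m _ n _ hmn => Finset.disjoint_left.2 fun x hm hn =>
    hmn ((mem_sphere.1 hm).symm.trans (mem_sphere.1 hn))]
  calc (N : ℝ) = ∑ _ ∈ Finset.Icc 1 N, (1 : ℝ) := by simp
    _ ≤ ∑ m ∈ Finset.Icc 1 N, (sphereCard S m : ℝ) * Real.exp (-growthRate S) ^ m :=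
        Finset.sum_le_sum fun m _ => one_le_sphereCard_mul_exp_pow hS hfin m
    _ = ∑ m ∈ Finset.Icc 1 N, ∑ x ∈ sphere m, Real.exp (-growthRate S) ^ cayleyLength S x :=
        Finset.sum_congr rfl fun m _ => by
          rw [Finset.sum_congr rfl fun x hx => by rw [mem_sphere.1 hx], Finset.sum_const,
            nsmul_eq_mul, sphereCard,
            Set.ncard_eq_toFinset_card _ (finite_setOf_cayleyLength_eq hS hfin m)]

theorem exists_finset_letters_one_lt_sum_mul_sum [Fintype ι] [Nontrivial ι]
    (hΓ : ¬ (Fintype.card ι = 2 ∧ ∀ i, Nat.card (Γ i) = 2)) {S : ∀ i, Set (Γ i)}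
    (i : ι) (hfin : (S i).Finite) (hgen : Subgroup.closure (S i) = ⊤) :
    ∃ (T : Finset (Γ i)) (Y : Finset (Σ k, Γ k)), (∀ x ∈ T, x ≠ 1) ∧
      (∀ y ∈ Y, y.2 ≠ 1 ∧ y.1 ≠ i) ∧
      1 < (∑ x ∈ T, Real.exp (-growthRate (S i)) ^ cayleyLength (S i) x) *
        ∑ y ∈ Y, Real.exp (-growthRate (S i)) ^ cayleyLength (S y.1) y.2 := by
  obtain hΓi | hΓi := finite_or_infinite (Γ i)
  · obtain ⟨T, Y, hT, hY, hcard⟩ := exists_finset_letters_one_lt_card_mul_card hΓ i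
    refine ⟨T, Y, hT, hY, ?_⟩
    simpa [growthRate_eq_zero_of_finite] using mod_cast hcard
  · obtain ⟨j, hj⟩ := exists_ne i
    obtain ⟨b, hb⟩ := exists_ne (1 : Γ j)
    obtain ⟨N, hN⟩ := exists_nat_gt (Real.exp (-growthRate (S i)) ^ cayleyLength (S j) b)⁻¹
    obtain ⟨T, hT, hNT⟩ := exists_finset_le_sum_exp_pow_cayleyLength hgen hfin N
    refine ⟨T, {⟨j, b⟩}, hT, by simp [hb, hj], ?_⟩
    rw [Finset.sum_singleton, ← inv_lt_iff_one_lt_mul₀ (by positivity)]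
    exact hN.trans_le hNT

end Letters

theorem corollary3p6 {ι : Type*} [Fintype ι] (hι : 2 ≤ Fintype.card ι)
    (Γ : ι → Type*) [∀ i, Group (Γ i)] [∀ i, Nontrivial (Γ i)]
    (hΓ : ¬ (Fintype.card ι = 2 ∧ ∀ i, Nat.card (Γ i) = 2))
    (S : ∀ i, Set (Γ i)) (hfin : ∀ i, (S i).Finite)
    (hsymm : ∀ i, ∀ s ∈ S i, s⁻¹ ∈ S i) (hgen : ∀ i, Subgroup.closure (S i) = ⊤)
    (α : ℝ) (hα0 : 0 < α) (hα1 : α < 1) (i : ι) :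
    endHausdorffDim S α (factorEnds S i) < endHausdorffDim S α (infiniteWordEnds S) := by
  have : Nontrivial ι := Fintype.one_lt_card_iff_nontrivial.1 hι
  obtain ⟨T, Y, hT, hY, hsum⟩ :=
    exists_finset_letters_one_lt_sum_mul_sum hΓ i (hfin i) (hgen i)
  rw [← rpow_growthExponent (S i) hα0 hα1] at hsum
  calc endHausdorffDim S α (factorEnds S i) ≤ growthExponent (S i) α :=
        endHausdorffDim_factorEnds_le hfin hgen hα0 hα1 i
    _ < endHausdorffDim S α (infiniteWordEnds S) :=
        lt_endHausdorffDim_infiniteWordEnds hgen hα0 hα1 hT hY hsum
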